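/- **Setting.** Let $\mathrm{Hol}$ be the space of holomorphic functions on the upper half plane and $H=\bigoplus_{n\in\mathbb{R}}H_n$ with $H_n=\mathrm{Hol}$; write $(f,n)$ for $f$ regarded as an element of $H_n$. An endomorphism of $H$ has weight $i$ if it maps $H_n$ into $H_{n+i}$ for every $n\in\mathbb{R}$. Let $D_kf=\frac{1}{2\pi i}\frac{df}{dz}-\frac{k}{12}E_2f$, where $E_k$ is the normalized Eisenstein series of weight $k$, and define $\mathbb{C}$-linear endomorphisms of $H$ by $\delta(f,n)=(D_nf,n+2)$, $e_4(f,n)=(E_4f,n+4)$, $e_6(f,n)=(E_6f,n+6)$. Let $\mathcal{R}$ be the $\mathbb{C}$-subalgebra of $\mathrm{End}_{\mathbb{C}}(H)$ generated by $\delta,e_4,e_6$, and let $\mathcal{R}_n$ be the space of its elements of weight $n$. Let $\mathcal{M}=\bigoplus_k\mathcal{M}_k$ be the graded ring of holomorphic modular forms on $\mathrm{SL}(2,\mathbb{Z})$; identify $F\in\mathcal{M}_k$ with the operator $(f,n)\mapsto(Ff,n+k)$, so that $\mathcal{M}=\mathbb{C}[E_4,E_6]$ becomes the subalgebra of $\mathcal{R}$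 generated by $e_4,e_6$. Every $a\in\mathcal{R}\setminus\{0\}$ can be written uniquely as $a=a_n\delta^n+\cdots+a_1\delta+a_0$ with $a_k\in\mathcal{M}$ and $a_n\ne0$; put $\mathrm{ord}(a)=n$, $\mathrm{top}(a)=a_n$, and $\mathrm{ord}(0)=-\infty$, $\mathrm{top}(0)=0$. Let $\mathcal{R}^i$ (resp. $\mathcal{R}^{<i}$) be the set of $a\in\mathcal{R}$ with $\mathrm{ord}(a)=i$ (resp. $\mathrm{ord}(a)<i$), and $\mathcal{R}^i_n=\mathcal{R}^i\cap\mathcal{R}_n$, $\mathcal{R}^{<i}_n=\mathcal{R}^{<i}\cap\mathcal{R}_n$. **Theorem.** (A) (Inhomogeneous division.) Let $a\in\mathcal{R}^i$ and $b\in\mathcal{R}^j$ with $i\ge j\ge0$, and let $d,a',b'\in\mathcal{M}$ satisfy $\mathrm{top}(a)=a'd$ and $\mathrm{top}(b)=b'd$. Then 1. $\mathrm{top}(b)^{i-j}\,b'\,a=cb+c'$ for some $c\in\mathcal{R}^{i-j}$ and $c'\in\mathcal{R}^{<j}$; 2. $a\,\mathrm{top}(b)^{i-j}\,b'=bc+c'$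 for some $c\in\mathcal{R}^{i-j}$ and $c'\in\mathcal{R}^{<j}$. (B) (Homogeneous division.) Let $a\in\mathcal{R}^i_n$ and $b\in\mathcal{R}^j_m$ with $i\ge j\ge0$ and $m,n\ge0$, and let $d\in\mathcal{M}_l$, $a'\in\mathcal{M}_{n-2i-l}$, $b'\in\mathcal{M}_{m-2j-l}$ satisfy $\mathrm{top}(a)=a'd$ and $\mathrm{top}(b)=b'd$. Put $p=(m-2j)(i-j+1)-l-m+n$ and $q=(m-2j)(i-j+1)-l+n$. Then 1. $\mathrm{top}(b)^{i-j}\,b'\,a=cb+c'$ for some $c\in\mathcal{R}^{i-j}_p$ and $c'\in\mathcal{R}^{<j}_q$; 2. $a\,\mathrm{top}(b)^{i-j}\,b'=bc+c'$ for some $c\in\mathcal{R}^{i-j}_p$ and $c'\in\mathcal{R}^{<j}_q$; 3. $a\,\mathrm{top}(b)^{i-j}\,b'=cb+c'$ for some $c\in\mathcal{R}^{i-j}_p$ and $c'\in\mathcal{R}^{<j}_q$. -/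

import Mathlib

open UpperHalfPlane
open scoped Manifold MatrixGroups ModularForm DirectSum

noncomputable section

namespace MLDO

/-- The algebra `Hol` of holomorphic functions on the upper half plane. -/
def Hol : Subalgebra ℂ (ℍ → ℂ) where
  carrier := {f | MDifferentiable 𝓘(ℂ) 𝓘(ℂ) f}
  mul_mem' hf hg := MDifferentiable.mul hf hg
  add_mem' hf hg := MDifferentiable.add hf hg
  algebraMap_mem' _ := mdifferentiable_const

/-- `H = ⨁_{n ∈ ℝ} H_n` with every `H_n = Hol`. The element `(f, n)` is `Finsupp.single n f`. -/
abbrev H : Type := ℝ →₀ Hol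

/-- All `ℂ`-linear endomorphisms of `H`. -/
abbrev EndH : Type := Module.End ℂ H

/-- `End^i(H)`: the endomorphisms which map `H_n` into `H_{n+i}` for every real `n`. -/
def endWeight (i : ℝ) : Submodule ℂ EndH where
  carrier := {φ | ∀ (n : ℝ) (f : Hol), ∃ g : Hol, φ (Finsupp.single n f) = Finsupp.single (n + i) g}
  add_mem' := by
    intro φ ψ hφ hψ n f
    obtain ⟨g, hg⟩ := hφ n f
    obtain ⟨g', hg'⟩ := hψ n f
    exact ⟨g + g', by rw [LinearMap.add_apply, hg, hg', Finsupp.single_add]⟩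
  zero_mem' := fun n f => ⟨0, by simp⟩
  smul_mem' := by
    intro c φ hφ n f
    obtain ⟨g, hg⟩ := hφ n f
    exact ⟨c • g, by rw [LinearMap.smul_apply, hg, Finsupp.smul_single]⟩

/-- The endomorphism `(f, n) ↦ (T n f, n + r)` of `H`. -/
def shift (r : ℝ) (T : ℝ → (Hol →ₗ[ℂ] Hol)) : EndH :=
  Finsupp.lsum ℂ fun n => (Finsupp.lsingle (n + r)) ∘ₗ T n

theorem shift_single (r : ℝ) (T : ℝ → (Hol →ₗ[ℂ] Hol)) (n : ℝ) (f : Hol) :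
    shift r T (Finsupp.single n f) = Finsupp.single (n + r) (T n f) := by
  simp [shift]

/-- The Ramanujan-Serre operator `D_k f = (2πi)⁻¹ df/dz - (k/12) E₂ f` on `Hol`. -/
def serre (k : ℝ) : Hol →ₗ[ℂ] Hol where
  toFun f := ⟨Derivative.serreDerivative (k : ℂ) f.1,
    Derivative.serreDerivative_mdifferentiable (k : ℂ) f.2⟩
  map_add' f g := Subtype.ext (Derivative.serreDerivative_add (k : ℂ) f.1 g.1 f.2 g.2)
  map_smul' c f := Subtype.ext (Derivative.serreDerivative_smul (k : ℂ) c f.1 f.2)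

/-- `δ (f, n) = (D_n f, n + 2)`. -/
def delta : EndH := shift 2 serre

/-- A modular form of integer weight `k` on `SL(2, ℤ)`, seen as an element of `Hol`. -/
def toHol (k : ℤ) : ModularForm 𝒮ℒ k →ₗ[ℂ] Hol where
  toFun f := ⟨f, f.holo'⟩
  map_add' _ _ := rfl
  map_smul' _ _ := rfl

/-- For a modular form `F` of weight `k`, the endomorphism `(f, n) ↦ (F f, n + k)`. -/
def mulForm (k : ℤ) : ModularForm 𝒮ℒ k →ₗ[ℂ] EndH where
  toFun F := shift k fun _ => LinearMap.mulLeft ℂ (toHol k F)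
  map_add' F G := by
    refine Finsupp.lhom_ext fun n f => ?_
    rw [LinearMap.add_apply]
    simp only [shift_single, LinearMap.mulLeft_apply, map_add, add_mul, Finsupp.single_add]
  map_smul' c F := by
    refine Finsupp.lhom_ext fun n f => ?_
    rw [LinearMap.smul_apply]
    simp only [shift_single, LinearMap.mulLeft_apply, map_smul, smul_mul_assoc,
      Finsupp.smul_single, RingHom.id_apply]

theorem mulForm_single (k : ℤ) (F : ModularForm 𝒮ℒ k) (n : ℝ) (f : Hol) :
    mulForm k F (Finsupp.single n f) = Finsupp.single (n + k) (toHol k F * f) :=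
  shift_single _ _ _ _

/-- `e₄ (f, n) = (E₄ f, n + 4)`. -/
def e4 : EndH := mulForm 4 ModularForm.E₄

/-- `e₆ (f, n) = (E₆ f, n + 6)`. -/
def e6 : EndH := mulForm 6 ModularForm.E₆

/-- The algebra `R` of modular linear differential operators, generated by `δ`, `e₄`, `e₆`. -/
def R : Subalgebra ℂ EndH := Algebra.adjoin ℂ {delta, e4, e6}

/-- The weight `n` part `R_n` of `R`. -/
def RWeight (n : ℤ) : Submodule ℂ EndH := Subalgebra.toSubmodule R ⊓ endWeight (n : ℝ)

/-- The graded ring of modular forms on `SL(2, ℤ)` (there are no nonzero ones of odd weight). -/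
abbrev M : Type := ⨁ k : ℤ, ModularForm 𝒮ℒ k

/-- The weight `k` part of `M`. -/
def MWeight (k : ℤ) : Submodule ℂ M :=
  LinearMap.range (DirectSum.lof ℂ ℤ (fun k => ModularForm 𝒮ℒ k) k)

/-- The algebra homomorphism `ι : M → End(H)` which identifies a modular form `F` of weight `k`
with the operator `(f, n) ↦ (F f, n + k)`; in particular it maps `E₄` to `e₄` and `E₆` to `e₆`. -/
def iota : M →ₐ[ℂ] EndH :=
  DirectSum.toAlgebra ℂ (fun k => ModularForm 𝒮ℒ k) mulForm
    (by
      refine Finsupp.lhom_ext fun n f => ?_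
      rw [mulForm_single]
      have h : toHol 0 GradedMonoid.GOne.one = 1 := Subtype.ext (funext fun _ => rfl)
      rw [h]
      simp)
    (by
      intro k l F G
      refine Finsupp.lhom_ext fun n f => ?_
      rw [Module.End.mul_apply, mulForm_single, mulForm_single, mulForm_single]
      have h : toHol (k + l) (GradedMonoid.GMul.mul F G) = toHol k F * toHol l G :=
        Subtype.ext (funext fun _ => rfl)
      rw [h, mul_assoc]
      congr 1
      push_cast
      ring)

theorem iota_lof (k : ℤ) (F : ModularForm 𝒮ℒ k) :
    iota (DirectSum.lof ℂ ℤ (fun k => ModularForm 𝒮ℒ k) k F) = mulForm k F :=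
  DirectSum.toModule_lof ℂ (φ := mulForm) k F

/-- The operator `a_n δ^n + ⋯ + a_1 δ + a_0` with coefficients `a_k ∈ M`. The polynomial only
records the finite sequence of coefficients; its multiplication plays no role. -/
def ofCoeffs (P : Polynomial M) : EndH := P.sum fun k f => iota f * delta ^ k

open Classical in
/-- The coefficients `a_k ∈ M` in the (unique) expression `a = a_n δ^n + ⋯ + a_1 δ + a_0`.
Every element of `R` has such an expression; the value is `0` for operators that have none. -/
def coeffs (a : EndH) : Polynomial M :=
  if h : ∃ P : Polynomial M, ofCoeffs P = a then h.choose else 0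

/-- The order of an operator; it is `⊥`, that is `-∞`, for `a = 0`. -/
def ord (a : EndH) : WithBot ℕ := (coeffs a).degree

/-- The top of an operator, that is the coefficient of its highest power of `δ`;
it is `0` for `a = 0`. -/
def top (a : EndH) : M := (coeffs a).leadingCoeff

end MLDO

end

/-!
Let `θ` be the Serre derivative on modular forms, so that `δ f = f δ + θ f` and
`δⁿ f = ∑ᵢ (n choose i) θⁿ⁻ⁱ(f) δⁱ`. Leading coefficients are therefore multiplicative: with
`α = top a` and `β = top b`, both `b' a - a' δ^(i-j) b` and `a b' - b a' δ^(i-j)` have order less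
than `i`, because `b' α = a' β`. Each further multiplication by `β` lets one subtract a multiple of
`b` which lowers the order by one, and after `i - j` of them the remainder has order less than `j`.

For `a β^(i-j) b'` with the quotient on the left of `b`, the Leibniz rule moves the coefficient to
the left of each `δˡ`. A `k`-fold Serre derivative of `β^(i-j) b'` is still divisible by
`β^(i-j-k) b'`, and a term that was differentiated `k` times has lost `k` orders as well, so the
remaining powers of `β` suffice for the division.

The homogeneous statements follow by projecting the quotient and the remainder to their weight
parts. Uniqueness of coefficients, hence the exact order of the quotient, holds because `δ` lowers
the order of vanishing of `(z - z₀)^N` at `z₀` by exactly one, so `f δⁿ` is not a combination of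
lower powers of `δ` unless `f = 0`.
-/

noncomputable section

namespace MLDO

section Filtration

variable {k S A : Type*} [CommRing k] [CommRing S] [Ring A] [Algebra k S] [Algebra k A]
variable (ι : S →ₐ[k] A) (δ : A)

/-- The operators of order less than `n`, that is the span of the monomials `f δ ^ i` with `i < n`.
The coefficient ring `S` acts through `ι`. -/
def orderLT (n : ℕ) : Submodule k A :=
  Submodule.span k {a | ∃ i < n, ∃ f, ι f * δ ^ i = a}

variable {ι δ} {m n : ℕ} {f g : S} {a b : A}

theorem iota_mul_pow_mem_orderLT {i : ℕ} (hi : i < n) (f : S) : ι f * δ ^ i ∈ orderLT ι δ n :=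
  Submodule.subset_span ⟨i, hi, f, rfl⟩

theorem iota_mem_orderLT_one (f : S) : ι f ∈ orderLT ι δ 1 := by
  simpa only [pow_zero, mul_one] using iota_mul_pow_mem_orderLT (ι := ι) (δ := δ) one_pos f

theorem pow_mem_orderLT (h : m < n) : δ ^ m ∈ orderLT ι δ n := by
  simpa only [map_one, one_mul] using iota_mul_pow_mem_orderLT (ι := ι) (δ := δ) h 1

theorem orderLT_le_iff {N : Submodule k A} :
    orderLT ι δ n ≤ N ↔ ∀ i < n, ∀ f, ι f * δ ^ i ∈ N := by
  refine Submodule.span_le.trans ⟨fun h i hi f => h ⟨i, hi, f, rfl⟩, ?_⟩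
  rintro h _ ⟨i, hi, f, rfl⟩
  exact h i hi f

theorem orderLT_mono (h : m ≤ n) : orderLT ι δ m ≤ orderLT ι δ n :=
  orderLT_le_iff.mpr fun _ hi f => iota_mul_pow_mem_orderLT (hi.trans_le h) f

theorem iota_mul_mem_orderLT (f : S) (ha : a ∈ orderLT ι δ n) : ι f * a ∈ orderLT ι δ n := by
  have h : orderLT ι δ n ≤ (orderLT ι δ n).comap (LinearMap.mulLeft k (ι f)) :=
    orderLT_le_iff.mpr fun i hi g => by
      simpa only [Submodule.mem_comap, LinearMap.mulLeft_apply, ← mul_assoc, ← map_mul]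
        using iota_mul_pow_mem_orderLT hi (f * g)
  exact h ha

open Polynomial in
theorem eval₂_mem_orderLT {P : S[X]} (hP : P.degree < n) :
    P.eval₂ (ι : S →+* A) δ ∈ orderLT ι δ n := by
  rw [eval₂_eq_sum]
  exact Submodule.sum_mem _ fun i hi => iota_mul_pow_mem_orderLT
    (Nat.cast_lt.mp ((le_degree_of_mem_supp i hi).trans_lt hP)) _

open Polynomial in
theorem mem_orderLT_iff :
    a ∈ orderLT ι δ n ↔ ∃ P : S[X], P.degree < n ∧ P.eval₂ (ι : S →+* A) δ = a := by
  refine ⟨fun ha => ?_, fun ⟨P, hP, hPa⟩ => hPa ▸ eval₂_mem_orderLT hP⟩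
  induction ha using Submodule.span_induction with
  | mem x hx =>
    obtain ⟨i, hi, f, rfl⟩ := hx
    exact ⟨monomial i f, (degree_monomial_le i f).trans_lt (Nat.cast_lt.mpr hi),
      eval₂_monomial _ _⟩
  | zero => exact ⟨0, by simp, eval₂_zero _ _⟩
  | add x y _ _ hx hy =>
    obtain ⟨P, hP, rfl⟩ := hx
    obtain ⟨Q, hQ, rfl⟩ := hy
    exact ⟨P + Q, (degree_add_le P Q).trans_lt (max_lt hP hQ), eval₂_add _ _⟩
  | smul c x _ hx =>
    obtain ⟨P, hP, rfl⟩ := hx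
    refine ⟨C (algebraMap k S c) * P, ?_, ?_⟩
    · rw [← smul_eq_C_mul, algebraMap_smul]
      exact (degree_smul_le c P).trans_lt hP
    · rw [← smul_eq_C_mul, eval₂_smul, RingHom.coe_coe, AlgHom.commutes, Algebra.smul_def]

variable (ι δ) in
/-- `a` has order at most `n` and its coefficient at `δ ^ n` is `f`; the symbol `f` may vanish. -/
def HasSymbol (n : ℕ) (f : S) (a : A) : Prop := a - ι f * δ ^ n ∈ orderLT ι δ n

theorem HasSymbol.mem_orderLT (ha : HasSymbol ι δ n f a) : a ∈ orderLT ι δ (n + 1) := by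
  simpa only [sub_add_cancel] using
    add_mem (orderLT_mono n.le_succ ha) (iota_mul_pow_mem_orderLT n.lt_succ_self f)

theorem hasSymbol_iota_mul_pow (n : ℕ) (f : S) : HasSymbol ι δ n f (ι f * δ ^ n) := by
  simp only [HasSymbol, sub_self, zero_mem]

theorem hasSymbol_iota (f : S) : HasSymbol ι δ 0 f (ι f) := by
  simpa only [pow_zero, mul_one] using hasSymbol_iota_mul_pow (ι := ι) (δ := δ) 0 f

theorem HasSymbol.sub_mem_orderLT (ha : HasSymbol ι δ n f a) (hb : HasSymbol ι δ n f b) :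
    a - b ∈ orderLT ι δ n := by
  simpa only [sub_sub_sub_cancel_right] using sub_mem ha hb

open Polynomial in
theorem exists_hasSymbol (ha : a ∈ orderLT ι δ (n + 1)) : ∃ f, HasSymbol ι δ n f a := by
  obtain ⟨P, hP, rfl⟩ := mem_orderLT_iff.mp ha
  have hP' : P.natDegree < n + 1 :=
    Nat.lt_succ_of_le (natDegree_le_iff_coeff_eq_zero.mpr fun _ hi =>
      coeff_eq_zero_of_degree_lt (hP.trans_le (Nat.cast_le.mpr hi)))
  refine ⟨P.coeff n, ?_⟩
  rw [HasSymbol, eval₂_eq_sum_range' _ hP', Finset.sum_range_succ]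
  simp only [RingHom.coe_coe, add_sub_cancel_right]
  exact Submodule.sum_mem _ fun i hi => iota_mul_pow_mem_orderLT (Finset.mem_range.mp hi) _

theorem HasSymbol.notMem_orderLT (hind : ∀ n f, ι f * δ ^ n ∈ orderLT ι δ n → f = 0)
    (ha : HasSymbol ι δ n f a) (hf : f ≠ 0) : a ∉ orderLT ι δ n := fun h =>
  hf (hind n f (by simpa only [sub_sub_cancel] using sub_mem h ha))

open Polynomial in
theorem eval₂_injective_of_forall_mem_orderLT
    (hind : ∀ n f, ι f * δ ^ n ∈ orderLT ι δ n → f = 0) :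
    Function.Injective fun P : S[X] => P.eval₂ (ι : S →+* A) δ := by
  refine (injective_iff_map_eq_zero (eval₂AddMonoidHom (ι : S →+* A) δ)).mpr fun P hP => ?_
  by_contra hP0
  refine hP0 (leadingCoeff_eq_zero.mp (hind P.natDegree _ ?_))
  have h := P.eraseLead_add_monomial_natDegree_leadingCoeff
  have heval := congrArg (eval₂ (ι : S →+* A) δ) h
  rw [eval₂_add, eval₂_monomial, show eval₂ _ δ P = 0 from hP] at heval
  rw [← RingHom.coe_coe, eq_neg_of_add_eq_zero_right heval]
  exact neg_mem (eval₂_mem_orderLT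
    ((degree_eraseLead_lt hP0).trans_eq (degree_eq_natDegree hP0)))

end Filtration

section Leibniz

variable {k S A : Type*} [CommRing k] [CommRing S] [Ring A] [Algebra k S] [Algebra k A]
variable {ι : S →ₐ[k] A} {δ : A} {θ : Derivation k S S}
variable {j m n r s : ℕ} {f g β : S} {a b : A}

theorem pow_mul_iota (hδ : ∀ f, δ * ι f = ι f * δ + ι (θ f)) (n : ℕ) (f : S) :
    δ ^ n * ι f = ∑ i ∈ Finset.range (n + 1), n.choose i • (ι (θ^[n - i] f) * δ ^ i) := by
  -- `δ • = • δ + [δ, •]`, where `[δ, •]` commutes with `• δ` and restricts to `θ` on coefficients.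
  have hcomm : Commute (LinearMap.mulRight k δ) (LinearMap.mulLeft k δ - LinearMap.mulRight k δ) :=
    ((LinearMap.commute_mulLeft_right δ δ).symm).sub_right (Commute.refl _)
  have hbracket (i : ℕ) :
      ((LinearMap.mulLeft k δ - LinearMap.mulRight k δ) ^ i) (ι f) = ι (θ^[i] f) := by
    induction i with
    | zero => rfl
    | succ i ih =>
      rw [pow_succ', Module.End.mul_apply, ih, Function.iterate_succ_apply', LinearMap.sub_apply,
        LinearMap.mulLeft_apply, LinearMap.mulRight_apply, hδ, add_sub_cancel_left]
  have hbinom := LinearMap.congr_fun (hcomm.add_pow n) (ι f)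
  rw [add_sub_cancel, LinearMap.pow_mulLeft, LinearMap.mulLeft_apply] at hbinom
  rw [hbinom, LinearMap.sum_apply]
  refine Finset.sum_congr rfl fun i _ => ?_
  rw [← nsmul_eq_mul', LinearMap.smul_apply, Module.End.mul_apply, hbracket,
    LinearMap.pow_mulRight, LinearMap.mulRight_apply]

theorem hasSymbol_pow_mul_iota (hδ : ∀ f, δ * ι f = ι f * δ + ι (θ f)) (n : ℕ) (f : S) :
    HasSymbol ι δ n f (δ ^ n * ι f) := by
  rw [HasSymbol, pow_mul_iota hδ, Finset.sum_range_succ, Nat.choose_self, one_smul, Nat.sub_self,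
    Function.iterate_zero_apply, add_sub_cancel_right]
  exact Submodule.sum_mem _ fun i hi =>
    nsmul_mem (iota_mul_pow_mem_orderLT (Finset.mem_range.mp hi) _) _

theorem mul_mem_orderLT (hδ : ∀ f, δ * ι f = ι f * δ + ι (θ f)) (hs : m + n ≤ s + 1)
    (ha : a ∈ orderLT ι δ m) (hb : b ∈ orderLT ι δ n) : a * b ∈ orderLT ι δ s := by
  have hmonomial (i l : ℕ) (hi : i < m) (hl : l < n) (f g : S) :
      ι f * δ ^ i * (ι g * δ ^ l) ∈ orderLT ι δ s := by
    have hpow : orderLT ι δ (i + 1) ≤ (orderLT ι δ s).comap (LinearMap.mulRight k (δ ^ l)) :=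
      orderLT_le_iff.mpr fun t ht h => by
        simpa only [Submodule.mem_comap, LinearMap.mulRight_apply, mul_assoc, ← pow_add]
          using iota_mul_pow_mem_orderLT (by omega) h
    simpa only [LinearMap.mulRight_apply, mul_assoc, Submodule.mem_comap]
      using hpow (iota_mul_mem_orderLT f (hasSymbol_pow_mul_iota hδ i g).mem_orderLT)
  have hle : orderLT ι δ m * orderLT ι δ n ≤ orderLT ι δ s := by
    rw [orderLT, orderLT, Submodule.span_mul_span, Submodule.span_le]
    rintro _ ⟨_, ⟨i, hi, f, rfl⟩, _, ⟨l, hl, g, rfl⟩, rfl⟩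
    exact hmonomial i l hi hl f g
  exact hle (Submodule.mul_mem_mul ha hb)

theorem HasSymbol.mul (hδ : ∀ f, δ * ι f = ι f * δ + ι (θ f)) (ha : HasSymbol ι δ m f a)
    (hb : HasSymbol ι δ n g b) : HasSymbol ι δ (m + n) (f * g) (a * b) := by
  have hleft : (a - ι f * δ ^ m) * b ∈ orderLT ι δ (m + n) :=
    mul_mem_orderLT hδ (by omega) ha hb.mem_orderLT
  have hright : ι f * δ ^ m * (b - ι g * δ ^ n) ∈ orderLT ι δ (m + n) :=
    mul_mem_orderLT hδ (by omega) (iota_mul_pow_mem_orderLT m.lt_succ_self f) hb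
  have hmid : ι f * ((δ ^ m * ι g - ι g * δ ^ m) * δ ^ n) ∈ orderLT ι δ (m + n) :=
    iota_mul_mem_orderLT f (mul_mem_orderLT hδ (by omega) (hasSymbol_pow_mul_iota hδ m g)
      (pow_mem_orderLT n.lt_succ_self))
  have hsplit : a * b - ι (f * g) * δ ^ (m + n) = (a - ι f * δ ^ m) * b +
      ι f * δ ^ m * (b - ι g * δ ^ n) + ι f * ((δ ^ m * ι g - ι g * δ ^ m) * δ ^ n) := by
    rw [pow_add, map_mul]
    noncomm_ring
  rw [HasSymbol, hsplit]
  exact add_mem (add_mem hleft hright) hmid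

theorem exists_mem_orderLT_of_mem_adjoin (hδ : ∀ f, δ * ι f = ι f * δ + ι (θ f))
    (ha : a ∈ Algebra.adjoin k (insert δ (Set.range ι))) : ∃ n, a ∈ orderLT ι δ n := by
  induction ha using Algebra.adjoin_induction with
  | mem x hx =>
    rcases hx with rfl | ⟨f, rfl⟩
    · exact ⟨2, by simpa only [pow_one] using pow_mem_orderLT (ι := ι) one_lt_two⟩
    · exact ⟨1, iota_mem_orderLT_one f⟩
  | algebraMap c => exact ⟨1, ι.commutes c ▸ iota_mem_orderLT_one _⟩
  | add x y _ _ hx hy =>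
    obtain ⟨n, hn⟩ := hx
    obtain ⟨m, hm⟩ := hy
    exact ⟨max n m, add_mem (orderLT_mono (le_max_left n m) hn)
      (orderLT_mono (le_max_right n m) hm)⟩
  | mul x y _ _ hx hy =>
    obtain ⟨n, hn⟩ := hx
    obtain ⟨m, hm⟩ := hy
    exact ⟨n + m, mul_mem_orderLT hδ (Nat.le_succ _) hn hm⟩

end Leibniz

section Division

variable {k S A : Type*} [CommRing k] [CommRing S] [Ring A] [Algebra k S] [Algebra k A]
variable (ι : S →ₐ[k] A) (δ : A)

/-- The operators `c b + c'` with `c` of order less than `r` and `c'` of order less than `j`. -/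
def leftDivisible (j r : ℕ) (b : A) : Submodule k A :=
  orderLT ι δ r * Submodule.span k {b} ⊔ orderLT ι δ j

/-- The operators `b c + c'` with `c` of order less than `r` and `c'` of order less than `j`. -/
def rightDivisible (j r : ℕ) (b : A) : Submodule k A :=
  Submodule.span k {b} * orderLT ι δ r ⊔ orderLT ι δ j

variable {ι δ} {θ : Derivation k S S} {j l r s : ℕ} {f g α β a' b' : S} {a b x : A}

theorem mem_leftDivisible_iff : x ∈ leftDivisible ι δ j r b ↔
    ∃ c ∈ orderLT ι δ r, ∃ c' ∈ orderLT ι δ j, x = c * b + c' := by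
  simp only [leftDivisible, Submodule.mem_sup, Submodule.mem_mul_span_singleton,
    exists_exists_and_eq_and, eq_comm (a := x)]

theorem mem_rightDivisible_iff : x ∈ rightDivisible ι δ j r b ↔
    ∃ c ∈ orderLT ι δ r, ∃ c' ∈ orderLT ι δ j, x = b * c + c' := by
  simp only [rightDivisible, Submodule.mem_sup, Submodule.mem_span_singleton_mul,
    exists_exists_and_eq_and, eq_comm (a := x)]

theorem leftDivisible_mono (h : s ≤ r) : leftDivisible ι δ j s b ≤ leftDivisible ι δ j r b :=
  sup_le_sup_right (mul_le_mul_left (orderLT_mono h) _) _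

theorem rightDivisible_mono (h : s ≤ r) : rightDivisible ι δ j s b ≤ rightDivisible ι δ j r b :=
  sup_le_sup_right (mul_le_mul_right (orderLT_mono h) _) _

theorem mul_mem_leftDivisible (b : A) (ha : a ∈ orderLT ι δ r) :
    a * b ∈ leftDivisible ι δ j r b :=
  Submodule.mem_sup_left (Submodule.mul_mem_mul ha (Submodule.mem_span_singleton_self b))

theorem mul_mem_rightDivisible (b : A) (ha : a ∈ orderLT ι δ r) :
    b * a ∈ rightDivisible ι δ j r b :=
  Submodule.mem_sup_left (Submodule.mul_mem_mul (Submodule.mem_span_singleton_self b) ha)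

theorem iota_mul_mem_leftDivisible (f : S) (hx : x ∈ leftDivisible ι δ j r b) :
    ι f * x ∈ leftDivisible ι δ j r b := by
  obtain ⟨c, hc, c', hc', rfl⟩ := mem_leftDivisible_iff.mp hx
  exact mem_leftDivisible_iff.mpr ⟨ι f * c, iota_mul_mem_orderLT f hc, ι f * c',
    iota_mul_mem_orderLT f hc', by rw [mul_add, mul_assoc]⟩

theorem mul_iota_mem_rightDivisible (hδ : ∀ f, δ * ι f = ι f * δ + ι (θ f)) (f : S)
    (hx : x ∈ rightDivisible ι δ j r b) : x * ι f ∈ rightDivisible ι δ j r b := by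
  obtain ⟨c, hc, c', hc', rfl⟩ := mem_rightDivisible_iff.mp hx
  have hmul {n : ℕ} {y : A} (hy : y ∈ orderLT ι δ n) : y * ι f ∈ orderLT ι δ n :=
    mul_mem_orderLT hδ le_rfl hy (iota_mem_orderLT_one f)
  exact mem_rightDivisible_iff.mpr ⟨c * ι f, hmul hc, c' * ι f, hmul hc',
    by rw [add_mul, mul_assoc]⟩

theorem iota_mul_sub_mul_mem_orderLT (hδ : ∀ f, δ * ι f = ι f * δ + ι (θ f))
    (ha : HasSymbol ι δ (j + r) α a) (hb : HasSymbol ι δ j β b) (hab : b' * α = a' * β) :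
    ι b' * a - ι a' * δ ^ r * b ∈ orderLT ι δ (j + r) := by
  have hleft := (hasSymbol_iota b').mul hδ ha
  have hright := (hasSymbol_iota_mul_pow r a').mul hδ hb
  rw [zero_add, hab] at hleft
  rw [add_comm] at hright
  exact hleft.sub_mem_orderLT hright

theorem mul_iota_sub_mul_mem_orderLT (hδ : ∀ f, δ * ι f = ι f * δ + ι (θ f))
    (ha : HasSymbol ι δ (j + r) α a) (hb : HasSymbol ι δ j β b) (hab : b' * α = a' * β) :
    a * ι b' - b * (ι a' * δ ^ r) ∈ orderLT ι δ (j + r) := by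
  have hleft := ha.mul hδ (hasSymbol_iota b')
  rw [add_zero, mul_comm, hab, mul_comm] at hleft
  exact hleft.sub_mem_orderLT (hb.mul hδ (hasSymbol_iota_mul_pow r a'))

theorem iota_pow_mul_mem_leftDivisible (hδ : ∀ f, δ * ι f = ι f * δ + ι (θ f))
    (hb : HasSymbol ι δ j β b) (ha : a ∈ orderLT ι δ (j + r)) :
    ι (β ^ r) * a ∈ leftDivisible ι δ j r b := by
  induction r generalizing a with
  | zero => exact Submodule.mem_sup_right (iota_mul_mem_orderLT _ ha)
  | succ r ih =>
    obtain ⟨α, hα⟩ := exists_hasSymbol ha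
    have hrest := leftDivisible_mono r.le_succ
      (ih (iota_mul_sub_mul_mem_orderLT hδ hα hb (mul_comm β α)))
    have hlead := iota_mul_mem_leftDivisible (ι := ι) (δ := δ) (β ^ r)
      (mul_mem_leftDivisible (j := j) b (iota_mul_pow_mem_orderLT r.lt_succ_self α))
    rw [pow_succ, map_mul, mul_assoc, ← sub_add_cancel (ι β * a) (ι α * δ ^ r * b), mul_add]
    exact add_mem hrest hlead

theorem mul_iota_pow_mem_rightDivisible (hδ : ∀ f, δ * ι f = ι f * δ + ι (θ f))
    (hb : HasSymbol ι δ j β b) (ha : a ∈ orderLT ι δ (j + r)) :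
    a * ι (β ^ r) ∈ rightDivisible ι δ j r b := by
  induction r generalizing a with
  | zero =>
    exact Submodule.mem_sup_right (mul_mem_orderLT hδ le_rfl ha (iota_mem_orderLT_one _))
  | succ r ih =>
    obtain ⟨α, hα⟩ := exists_hasSymbol ha
    have hrest := rightDivisible_mono r.le_succ
      (ih (mul_iota_sub_mul_mem_orderLT hδ hα hb (mul_comm β α)))
    have hlead := mul_iota_mem_rightDivisible hδ (β ^ r)
      (mul_mem_rightDivisible (j := j) b (iota_mul_pow_mem_orderLT r.lt_succ_self α))
    rw [pow_succ', map_mul, ← mul_assoc, ← sub_add_cancel (a * ι β) (b * (ι α * δ ^ r)), add_mul]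
    exact add_mem hrest hlead

theorem iota_pow_mul_mul_mem_leftDivisible (hδ : ∀ f, δ * ι f = ι f * δ + ι (θ f))
    (ha : HasSymbol ι δ (j + r) α a) (hb : HasSymbol ι δ j β b) (hab : b' * α = a' * β) :
    ι (β ^ r * b') * a ∈ leftDivisible ι δ j (r + 1) b := by
  have hrest := leftDivisible_mono r.le_succ
    (iota_pow_mul_mem_leftDivisible hδ hb (iota_mul_sub_mul_mem_orderLT hδ ha hb hab))
  have hlead := iota_mul_mem_leftDivisible (ι := ι) (δ := δ) (β ^ r)
    (mul_mem_leftDivisible (j := j) b (iota_mul_pow_mem_orderLT r.lt_succ_self a'))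
  rw [map_mul, mul_assoc, ← sub_add_cancel (ι b' * a) (ι a' * δ ^ r * b), mul_add]
  exact add_mem hrest hlead

theorem mul_iota_pow_mul_mem_rightDivisible (hδ : ∀ f, δ * ι f = ι f * δ + ι (θ f))
    (ha : HasSymbol ι δ (j + r) α a) (hb : HasSymbol ι δ j β b) (hab : b' * α = a' * β) :
    a * ι (β ^ r * b') ∈ rightDivisible ι δ j (r + 1) b := by
  have hrest := rightDivisible_mono r.le_succ
    (mul_iota_pow_mem_rightDivisible hδ hb (mul_iota_sub_mul_mem_orderLT hδ ha hb hab))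
  have hlead := mul_iota_mem_rightDivisible hδ (β ^ r)
    (mul_mem_rightDivisible (j := j) b (iota_mul_pow_mem_orderLT r.lt_succ_self a'))
  rw [mul_comm, map_mul, ← mul_assoc, ← sub_add_cancel (a * ι b') (b * (ι a' * δ ^ r)), add_mul]
  exact add_mem hrest hlead

theorem pow_mul_dvd_derivation (θ : Derivation k S S) (hb' : b' ∣ β)
    (hf : β ^ (s + 1) * b' ∣ f) : β ^ s * b' ∣ θ f := by
  obtain ⟨g, rfl⟩ := hf
  obtain ⟨d, rfl⟩ := hb'
  rw [mul_assoc, Derivation.leibniz, Derivation.leibniz_pow, Nat.add_sub_cancel]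
  refine dvd_add ⟨d * θ (b' * g), ?_⟩ ⟨g * (s + 1 : ℕ) * θ (b' * d), ?_⟩
  · rw [smul_eq_mul]
    ring
  · rw [smul_eq_mul, smul_eq_mul, nsmul_eq_mul]
    ring

theorem pow_mul_dvd_derivation_iterate (θ : Derivation k S S) (hb' : b' ∣ β) (i s : ℕ) :
    β ^ s * b' ∣ θ^[i] (β ^ (s + i) * b') := by
  induction i generalizing s with
  | zero => exact dvd_rfl
  | succ i ih =>
    rw [Function.iterate_succ_apply']
    refine pow_mul_dvd_derivation θ hb' ?_
    rw [show s + (i + 1) = s + 1 + i by ring]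
    exact ih (s + 1)

theorem iota_mul_pow_mul_iota_mem_leftDivisible (hδ : ∀ f, δ * ι f = ι f * δ + ι (θ f))
    (hb : HasSymbol ι δ j β b) (hl : l < j + s) (hdvd : ∀ i, β ^ (s - i) ∣ f * θ^[i] g) :
    ι f * δ ^ l * ι g ∈ leftDivisible ι δ j s b := by
  rw [mul_assoc, pow_mul_iota hδ, Finset.mul_sum]
  refine Submodule.sum_mem _ fun i hi => ?_
  rw [mul_smul_comm]
  refine nsmul_mem ?_ _
  obtain ⟨h, hh⟩ := hdvd (l - i)
  have hterm := iota_pow_mul_mem_leftDivisible (r := s - (l - i)) hδ hb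
    (iota_mul_pow_mem_orderLT (i := i) (by grind) h)
  rw [← mul_assoc, ← map_mul, hh, map_mul, mul_assoc]
  exact leftDivisible_mono (Nat.sub_le _ _) hterm

theorem mul_iota_pow_mul_mem_leftDivisible (hδ : ∀ f, δ * ι f = ι f * δ + ι (θ f))
    (ha : HasSymbol ι δ (j + r) α a) (hb : HasSymbol ι δ j β b) (hab : b' * α = a' * β)
    (hb' : b' ∣ β) : a * ι (β ^ r * b') ∈ leftDivisible ι δ j (r + 1) b := by
  have hdvd {i : ℕ} (hi : i ≤ r) : β ^ (r - i) * b' ∣ θ^[i] (β ^ r * b') := by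
    simpa only [Nat.sub_add_cancel hi] using pow_mul_dvd_derivation_iterate θ hb' i (r - i)
  have hrest : orderLT ι δ (j + r) ≤
      (leftDivisible ι δ j r b).comap (LinearMap.mulRight k (ι (β ^ r * b'))) := by
    refine orderLT_le_iff.mpr fun l hl f =>
      iota_mul_pow_mul_iota_mem_leftDivisible hδ hb hl fun i => ?_
    rcases le_or_gt i r with hi | hi
    · exact ((dvd_mul_right _ _).trans (hdvd hi)).mul_left f
    · simp only [Nat.sub_eq_zero_of_le hi.le, pow_zero, one_dvd]
  have hlead : ι α * δ ^ (j + r) * ι (β ^ r * b') ∈ leftDivisible ι δ j (r + 1) b := by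
    refine iota_mul_pow_mul_iota_mem_leftDivisible hδ hb (Nat.lt_succ_self _) fun i => ?_
    rcases le_or_gt i r with hi | hi
    · have hα : β ^ (r + 1 - i) ∣ α * (β ^ (r - i) * b') :=
        ⟨a', by rw [Nat.succ_sub hi, pow_succ, mul_left_comm, mul_comm α, hab]; ring⟩
      exact hα.trans (mul_dvd_mul_left α (hdvd hi))
    · simp only [Nat.sub_eq_zero_of_le (Nat.succ_le_of_lt hi), pow_zero, one_dvd]
  rw [← sub_add_cancel a (ι α * δ ^ (j + r)), add_mul]
  exact add_mem (leftDivisible_mono r.le_succ (hrest ha)) hlead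

theorem notMem_orderLT_of_mul_add_notMem_left (hδ : ∀ f, δ * ι f = ι f * δ + ι (θ f))
    {c c' : A} (hb : b ∈ orderLT ι δ (j + 1)) (hc' : c' ∈ orderLT ι δ j)
    (h : c * b + c' ∉ orderLT ι δ (j + r)) : c ∉ orderLT ι δ r := fun hc =>
  h (add_mem (mul_mem_orderLT hδ (by omega) hc hb) (orderLT_mono (Nat.le_add_right j r) hc'))

theorem notMem_orderLT_of_mul_add_notMem_right (hδ : ∀ f, δ * ι f = ι f * δ + ι (θ f))
    {c c' : A} (hb : b ∈ orderLT ι δ (j + 1)) (hc' : c' ∈ orderLT ι δ j)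
    (h : b * c + c' ∉ orderLT ι δ (j + r)) : c ∉ orderLT ι δ r := fun hc =>
  h (add_mem (mul_mem_orderLT hδ (by omega) hb hc) (orderLT_mono (Nat.le_add_right j r) hc'))

end Division

section ModularForms

open ModularForm EisensteinSeries

instance : NoZeroDivisors Hol where
  eq_zero_or_eq_zero_of_mul_eq_zero := by
    rintro ⟨f, hf⟩ ⟨g, hg⟩ hfg
    have hanalytic {f : ℍ → ℂ} (hf : MDifferentiable 𝓘(ℂ) 𝓘(ℂ) f) :
        AnalyticOnNhd ℂ (f ∘ ofComplex) upperHalfPlaneSet :=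
      (UpperHalfPlane.mdifferentiable_iff.mp hf).analyticOnNhd isOpen_upperHalfPlaneSet
    have hzero {f : ℍ → ℂ} (h : ∀ z ∈ upperHalfPlaneSet, (f ∘ ofComplex) z = 0) : f = 0 :=
      funext fun z => by simpa using h z z.im_pos
    exact (AnalyticOnNhd.eq_zero_or_eq_zero_of_mul_eq_zero (hanalytic hf) (hanalytic hg)
      (fun z _ => congrFun (congrArg Subtype.val hfg) (ofComplex z))
      (convex_halfSpace_im_gt 0).isPreconnected).imp
      (fun h => Subtype.ext (hzero h)) fun h => Subtype.ext (hzero h)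

theorem toHol_injective (k : ℤ) : Function.Injective (toHol k) := fun _ _ h =>
  DFunLike.coe_injective (congrArg Subtype.val h)

/-- The embedding of the graded ring `M` into the Laurent polynomials over `Hol`, in which a
modular form of weight `k` becomes a monomial of degree `k`. It shows that `M` is a domain. -/
def toLaurent : M →ₐ[ℂ] AddMonoidAlgebra Hol ℤ :=
  DirectSum.toAlgebra ℂ (fun k => ModularForm 𝒮ℒ k)
    (fun k => (AddMonoidAlgebra.lsingle k : Hol →ₗ[ℂ] AddMonoidAlgebra Hol ℤ) ∘ₗ toHol k)
    rfl
    fun F G => by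
      simp only [LinearMap.comp_apply, AddMonoidAlgebra.lsingle_apply,
        AddMonoidAlgebra.single_mul_single]
      rfl

theorem toLaurent_of (k : ℤ) (F : ModularForm 𝒮ℒ k) :
    toLaurent (DirectSum.of (ModularForm 𝒮ℒ) k F) = AddMonoidAlgebra.single k (toHol k F) :=
  DirectSum.toModule_lof ℂ (φ := fun k =>
    (AddMonoidAlgebra.lsingle k : Hol →ₗ[ℂ] AddMonoidAlgebra Hol ℤ) ∘ₗ toHol k) k F

theorem toLaurent_coeff (f : M) (k : ℤ) : (toLaurent f).coeff k = toHol k (f k) := by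
  induction f using DirectSum.induction_on with
  | zero => simp
  | add f g hf hg => simp [hf, hg]
  | of l F =>
    rw [toLaurent_of, AddMonoidAlgebra.coeff_single]
    rcases eq_or_ne l k with rfl | h
    · rw [Finsupp.single_eq_same, DirectSum.of_eq_same]
    · rw [Finsupp.single_eq_of_ne h.symm, DirectSum.of_eq_of_ne _ _ _ h.symm, map_zero]

theorem toLaurent_injective : Function.Injective toLaurent := fun f g h =>
  DFinsupp.ext fun k => toHol_injective k (by rw [← toLaurent_coeff, h, toLaurent_coeff])

instance : NoZeroDivisors M :=
  toLaurent_injective.noZeroDivisors toLaurent (map_zero _) (map_mul _)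

theorem isBoundedAtImInfty_normalizedDerivOfComplex {f : ℍ → ℂ}
    (hf : MDifferentiable 𝓘(ℂ) 𝓘(ℂ) f) (hb : IsBoundedAtImInfty f) :
    IsBoundedAtImInfty (Derivative.normalizedDerivOfComplex f) := by
  -- Cauchy's estimate on the unit disc around `z`, which for `Im z` large lies where `f` is bounded
  rw [isBoundedAtImInfty_iff] at hb ⊢
  obtain ⟨C, A, hC⟩ := hb
  refine ⟨‖(2 * Real.pi * Complex.I : ℂ)⁻¹‖ * C, max A 1 + 1, fun z hz => ?_⟩
  have him {w : ℂ} (hw : w ∈ Metric.closedBall (z : ℂ) 1) : max A 1 ≤ w.im := by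
    have hdist : |w.im - z.im| ≤ 1 := by
      simpa using (Complex.abs_im_le_norm (w - z)).trans (mem_closedBall_iff_norm.mp hw)
    linarith [(abs_le.mp hdist).1]
  have hpos {w : ℂ} (hw : w ∈ Metric.closedBall (z : ℂ) 1) : 0 < w.im :=
    zero_lt_one.trans_le ((le_max_right A 1).trans (him hw))
  have hbound (w : ℂ) (hw : w ∈ Metric.sphere (z : ℂ) 1) : ‖(f ∘ ofComplex) w‖ ≤ C := by
    have hw' := Metric.sphere_subset_closedBall hw
    rw [Function.comp_apply, ofComplex_apply_of_im_pos (hpos hw')]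
    exact hC _ ((le_max_left A 1).trans (him hw'))
  rw [Derivative.normalizedDerivOfComplex, norm_mul]
  gcongr
  exact (Complex.norm_deriv_le_of_forall_mem_sphere_norm_le one_pos
    ((UpperHalfPlane.mdifferentiable_iff.mp hf).diffContOnCl_ball fun w hw => hpos hw)
    hbound).trans_eq (div_one C)

theorem isBoundedAtImInfty_serreDerivative {k : ℂ} {f : ℍ → ℂ}
    (hf : MDifferentiable 𝓘(ℂ) 𝓘(ℂ) f) (hb : IsBoundedAtImInfty f) :
    IsBoundedAtImInfty (Derivative.serreDerivative k f) := by
  have h : Derivative.serreDerivative k f =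
      Derivative.normalizedDerivOfComplex f - (k * 12⁻¹) • (E2 * f) := by
    funext z
    simp only [Derivative.serreDerivative_apply, Pi.sub_apply, Pi.smul_apply, Pi.mul_apply,
      smul_eq_mul, mul_assoc]
  exact h ▸ (isBoundedAtImInfty_normalizedDerivOfComplex hf hb).sub
    ((isBoundedAtImInfty_E2.mul hb).smul (k * 12⁻¹))

/-- The Serre derivative `D_k` of a modular form of weight `k`, as a modular form of weight
`k + 2`. -/
def serreForm (k : ℤ) : ModularForm 𝒮ℒ k →ₗ[ℂ] ModularForm 𝒮ℒ (k + 2) where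
  toFun F :=
    { toFun := Derivative.serreDerivative k F
      slash_action_eq' := by
        rintro _ ⟨γ, rfl⟩
        exact Derivative.serreDerivative_slash_invariant F.holo' (F.slash_action_eq' _ ⟨γ, rfl⟩)
      holo' := Derivative.serreDerivative_mdifferentiable _ F.holo'
      bdd_at_cusps' hc := by
        rw [Subgroup.IsArithmetic.isCusp_iff_isCusp_SL2Z] at hc
        rw [OnePoint.isBoundedAt_iff_forall_SL2Z hc]
        intro γ _
        convert isBoundedAtImInfty_serreDerivative (k := k) F.holo'
          (ModularFormClass.bdd_at_infty F) using 1
        exact Derivative.serreDerivative_slash_invariant F.holo'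
          (F.slash_action_eq' _ ⟨γ, rfl⟩) }
  map_add' F G := DFunLike.coe_injective
    (Derivative.serreDerivative_add (k : ℂ) F G F.holo' G.holo')
  map_smul' c F := DFunLike.coe_injective (Derivative.serreDerivative_smul (k : ℂ) c F F.holo')

theorem toHol_serreForm (k : ℤ) (F : ModularForm 𝒮ℒ k) :
    toHol (k + 2) (serreForm k F) = serre k (toHol k F) :=
  Subtype.ext (congrArg (Derivative.serreDerivative · F) (Complex.ofReal_intCast k).symm)

/-- The subalgebra `ℂ[E₄, E₆]` of the ring of modular forms. -/
def eisensteinSubalgebra : Subalgebra ℂ M :=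
  Algebra.adjoin ℂ {DirectSum.of (ModularForm 𝒮ℒ) 4 E₄, DirectSum.of (ModularForm 𝒮ℒ) 6 E₆}

theorem of_E₄_mem_eisensteinSubalgebra :
    DirectSum.of (ModularForm 𝒮ℒ) 4 E₄ ∈ eisensteinSubalgebra :=
  Algebra.subset_adjoin (Set.mem_insert _ _)

theorem of_E₆_mem_eisensteinSubalgebra :
    DirectSum.of (ModularForm 𝒮ℒ) 6 E₆ ∈ eisensteinSubalgebra :=
  Algebra.subset_adjoin (Set.mem_insert_of_mem _ rfl)

theorem exists_eq_mul_four_add_mul_six {k : ℕ} (hk : Even k) (hk4 : 4 ≤ k) :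
    ∃ a b : ℕ, k = a * 4 + b * 6 := by
  obtain ⟨r, rfl⟩ := hk
  rcases Nat.even_or_odd' r with ⟨s, rfl | rfl⟩
  · exact ⟨s, 0, by omega⟩
  · exact ⟨s - 1, 1, by omega⟩

theorem of_pow_mul_pow_mem_eisensteinSubalgebra (a b : ℕ) :
    DirectSum.of (ModularForm 𝒮ℒ) (a * 4 + b * 6 : ℤ) ((E₄.pow a).mul (E₆.pow b)) ∈
      eisensteinSubalgebra := by
  have h : DirectSum.of (ModularForm 𝒮ℒ) (a * 4 + b * 6 : ℤ) ((E₄.pow a).mul (E₆.pow b)) =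
      DirectSum.of (ModularForm 𝒮ℒ) 4 E₄ ^ a * DirectSum.of (ModularForm 𝒮ℒ) 6 E₆ ^ b := by
    rw [directSum_of_pow, directSum_of_pow, DirectSum.of_mul_of]
    rfl
  exact h ▸ mul_mem (pow_mem of_E₄_mem_eisensteinSubalgebra a)
    (pow_mem of_E₆_mem_eisensteinSubalgebra b)

theorem qExpansion_coeff_zero_pow_mul_pow (a b : ℕ) :
    (qExpansion 1 ((E₄.pow a).mul (E₆.pow b))).coeff 0 = 1 := by
  have h4 := E_qExpansion_coeff_zero (k := 4) (by norm_num) ⟨2, rfl⟩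
  have h6 := E_qExpansion_coeff_zero (k := 6) (by norm_num) ⟨3, rfl⟩
  rw [PowerSeries.coeff_zero_eq_constantCoeff] at *
  rw [show ⇑((E₄.pow a).mul (E₆.pow b)) = ⇑(E₄.pow a) * ⇑(E₆.pow b) from rfl,
    ModularForm.qExpansion_mul_coe one_pos one_mem_strictPeriods_SL,
    ModularForm.qExpansion_pow one_pos one_mem_strictPeriods_SL,
    ModularForm.qExpansion_pow one_pos one_mem_strictPeriods_SL,
    map_mul, map_pow, map_pow, h4, h6, one_pow, one_pow, one_mul]

theorem exists_mem_eisensteinSubalgebra_qExpansion_coeff_zero {k : ℕ} (hk : Even k)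
    (hk4 : 4 ≤ k) : ∃ g : ModularForm 𝒮ℒ k,
      DirectSum.of (ModularForm 𝒮ℒ) k g ∈ eisensteinSubalgebra ∧
        (qExpansion 1 g).coeff 0 = 1 := by
  obtain ⟨a, b, hab⟩ := exists_eq_mul_four_add_mul_six hk hk4
  rw [show (k : ℤ) = a * 4 + b * 6 by exact_mod_cast hab]
  exact ⟨_, of_pow_mul_pow_mem_eisensteinSubalgebra a b, qExpansion_coeff_zero_pow_mul_pow a b⟩

theorem of_mem_eisensteinSubalgebra_of_neg {k : ℤ} (hk : k < 0) (F : ModularForm 𝒮ℒ k) :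
    DirectSum.of (ModularForm 𝒮ℒ) k F ∈ eisensteinSubalgebra := by
  rw [rank_zero_iff_forall_zero.mp (levelOne_neg_weight_rank_zero hk) F, map_zero]
  exact zero_mem _

theorem of_mem_eisensteinSubalgebra_of_odd {k : ℤ} (hk : Odd k) (F : ModularForm 𝒮ℒ k) :
    DirectSum.of (ModularForm 𝒮ℒ) k F ∈ eisensteinSubalgebra := by
  rw [levelOne_odd_weight_eq_zero hk F, map_zero]
  exact zero_mem _

theorem of_weight_zero_mem_eisensteinSubalgebra (F : ModularForm 𝒮ℒ 0) :
    DirectSum.of (ModularForm 𝒮ℒ) 0 F ∈ eisensteinSubalgebra := by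
  obtain ⟨c, hc⟩ := ModularFormClass.levelOne_weight_zero_const F
  have h : DirectSum.of (ModularForm 𝒮ℒ) 0 F = algebraMap ℂ M c := by
    rw [DirectSum.algebraMap_apply]
    congr 1
    exact DFunLike.ext _ _ fun z => congrFun hc z
  exact h ▸ Subalgebra.algebraMap_mem _ c

theorem of_weight_two_mem_eisensteinSubalgebra (F : ModularForm 𝒮ℒ 2) :
    DirectSum.of (ModularForm 𝒮ℒ) 2 F ∈ eisensteinSubalgebra := by
  rw [rank_zero_iff_forall_zero.mp levelOne_weight_two_rank_zero F, map_zero]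
  exact zero_mem _

theorem of_discriminant_mem_eisensteinSubalgebra :
    DirectSum.of (ModularForm 𝒮ℒ) 12 (CuspForm.toModularFormₗ CuspForm.discriminant) ∈
      eisensteinSubalgebra :=
  discriminant_eq_E₄_cube_sub_E₆_sq_graded ▸ Subalgebra.smul_mem _
    (sub_mem (pow_mem of_E₄_mem_eisensteinSubalgebra 3)
      (pow_mem of_E₆_mem_eisensteinSubalgebra 2)) _

theorem of_cuspForm_eq_discriminant_mul {k : ℤ} (F : CuspForm 𝒮ℒ k) :
    DirectSum.of (ModularForm 𝒮ℒ) k (CuspForm.toModularFormₗ F) =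
      DirectSum.of (ModularForm 𝒮ℒ) 12 (CuspForm.toModularFormₗ CuspForm.discriminant) *
        DirectSum.of (ModularForm 𝒮ℒ) (k - 12) (CuspForm.discriminantEquiv F) := by
  rw [DirectSum.of_mul_of]
  refine DirectSum.of_eq_of_gradedMonoid_eq
    (gradedMonoid_eq_of_cast (show k = 12 + (k - 12) by ring) ?_)
  ext z
  exact (discriminant_mul_discriminantEquiv_apply F z).symm

theorem of_mem_eisensteinSubalgebra (k : ℤ) (F : ModularForm 𝒮ℒ k) :
    DirectSum.of (ModularForm 𝒮ℒ) k F ∈ eisensteinSubalgebra := by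
  rcases lt_or_ge k 0 with hneg | hpos
  · exact of_mem_eisensteinSubalgebra_of_neg hneg F
  lift k to ℕ using hpos
  induction k using Nat.strong_induction_on with | h k ih =>
  rcases Nat.even_or_odd k with hk | hk
  swap
  · exact of_mem_eisensteinSubalgebra_of_odd (mod_cast hk) F
  rcases lt_or_ge k 4 with hk4 | hk4
  · obtain rfl | rfl : k = 0 ∨ k = 2 := by
      obtain ⟨r, rfl⟩ := hk
      omega
    · exact of_weight_zero_mem_eisensteinSubalgebra F
    · exact of_weight_two_mem_eisensteinSubalgebra F
  -- Subtract a monomial in `E₄, E₆` to get a cusp form, and divide it by the discriminant.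
  obtain ⟨g, hg, hg_coeff⟩ := exists_mem_eisensteinSubalgebra_qExpansion_coeff_zero hk hk4
  obtain ⟨s, hs⟩ := sub_smul_isCuspForm F g hg_coeff
  have hquot (G : ModularForm 𝒮ℒ (k - 12 : ℤ)) :
      DirectSum.of (ModularForm 𝒮ℒ) (k - 12 : ℤ) G ∈ eisensteinSubalgebra := by
    rcases lt_or_ge k 12 with h12 | h12
    · exact of_mem_eisensteinSubalgebra_of_neg (by omega) G
    · obtain ⟨l, rfl⟩ := Nat.exists_eq_add_of_le h12
      revert G
      rw [show ((12 + l : ℕ) : ℤ) - 12 = l by push_cast; ring]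
      exact ih l (by omega)
  rw [← sub_add_cancel F ((qExpansion 1 F).coeff 0 • g), ← hs, map_add, DirectSum.of_smul,
    of_cuspForm_eq_discriminant_mul]
  exact add_mem (mul_mem of_discriminant_mem_eisensteinSubalgebra (hquot _))
    (Subalgebra.smul_mem _ hg _)

theorem eisensteinSubalgebra_eq_top : eisensteinSubalgebra = ⊤ := by
  refine eq_top_iff.mpr fun f _ => ?_
  induction f using DirectSum.induction_on with
  | zero => exact zero_mem _
  | add f g hf hg => exact add_mem (hf trivial) (hg trivial)
  | of k F => exact of_mem_eisensteinSubalgebra k F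

end ModularForms

section OperatorAlgebra

theorem serre_mul (m n : ℝ) (f g : Hol) : serre (m + n) (f * g) = serre m f * g + f * serre n g :=
  Subtype.ext ((congrArg (Derivative.serreDerivative · (f.1 * g.1)) (Complex.ofReal_add m n)).trans
    (Derivative.serreDerivative_mul (m : ℂ) (n : ℂ) f.1 g.1 f.2 g.2))

theorem delta_mul_mulForm (k : ℤ) (F : ModularForm 𝒮ℒ k) :
    delta * mulForm k F = mulForm k F * delta + mulForm (k + 2) (serreForm k F) := by
  refine Finsupp.lhom_ext fun n f => ?_
  rw [LinearMap.add_apply, Module.End.mul_apply, Module.End.mul_apply, mulForm_single,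
    mulForm_single, delta, shift_single, shift_single, mulForm_single, toHol_serreForm,
    add_comm n (k : ℝ), serre_mul, add_comm (_ * f), Finsupp.single_add]
  congr 2 <;> push_cast <;> ring

theorem iota_of (k : ℤ) (F : ModularForm 𝒮ℒ k) :
    iota (DirectSum.of (ModularForm 𝒮ℒ) k F) = mulForm k F :=
  iota_lof k F

theorem iota_single_apply (f : M) (n : ℝ) (g : Hol) (k : ℤ) :
    (iota f (Finsupp.single n g)) (n + k) = toHol k (f k) * g := by
  induction f using DirectSum.induction_on with
  | zero => simp
  | add x y hx hy => simp [hx, hy, add_mul]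
  | of l F =>
    rw [iota_of, mulForm_single]
    rcases eq_or_ne l k with rfl | h
    · rw [Finsupp.single_eq_same, DirectSum.of_eq_same]
    · rw [Finsupp.single_eq_of_ne (by simpa using h.symm), DirectSum.of_eq_of_ne _ _ _ h.symm,
        map_zero, zero_mul]

theorem iota_injective : Function.Injective iota := fun f g h =>
  DFinsupp.ext fun k => toHol_injective k (by
    rw [← mul_one (toHol k (f k)), ← mul_one (toHol k (g k)), ← iota_single_apply f 0,
      ← iota_single_apply g 0, h])

/-- The Serre derivative on the graded ring of modular forms, equal to `D_k` in weight `k`. -/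
def serreLinearMap : M →ₗ[ℂ] M :=
  DirectSum.toModule ℂ ℤ M fun k =>
    DirectSum.lof ℂ ℤ (fun k => ModularForm 𝒮ℒ k) (k + 2) ∘ₗ serreForm k

theorem serreLinearMap_of (k : ℤ) (F : ModularForm 𝒮ℒ k) :
    serreLinearMap (DirectSum.of (ModularForm 𝒮ℒ) k F) =
      DirectSum.of (ModularForm 𝒮ℒ) (k + 2) (serreForm k F) :=
  DirectSum.toModule_lof ℂ k F

instance : Ring EndH := Algebra.semiringToRing ℂ

theorem delta_mul_iota_eq_add_serreLinearMap (f : M) :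
    delta * iota f = iota f * delta + iota (serreLinearMap f) := by
  induction f using DirectSum.induction_on with
  | zero => simp only [map_zero, mul_zero, zero_mul, add_zero]
  | add f g hf hg =>
    simp only [map_add, mul_add, add_mul, hf, hg]
    abel
  | of k F => rw [iota_of, serreLinearMap_of, iota_of, delta_mul_mulForm]

/-- The Serre derivative on the ring of modular forms as a derivation; it is the commutator with
`δ`, restricted to `M`. -/
def serreDerivation : Derivation ℂ M M :=
  Derivation.mk' serreLinearMap fun f g => iota_injective <| by
    have hbracket (h : M) : iota (serreLinearMap h) = delta * iota h - iota h * delta :=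
      eq_sub_of_add_eq' (delta_mul_iota_eq_add_serreLinearMap h).symm
    have hcomm : iota g * iota (serreLinearMap f) = iota (serreLinearMap f) * iota g := by
      rw [← map_mul, mul_comm, map_mul]
    rw [smul_eq_mul, smul_eq_mul, map_add, map_mul iota f, map_mul iota g, hcomm, hbracket,
      hbracket f, hbracket g, map_mul]
    noncomm_ring

theorem delta_mul_iota (f : M) : delta * iota f = iota f * delta + iota (serreDerivation f) :=
  delta_mul_iota_eq_add_serreLinearMap f

theorem delta_mem_R : delta ∈ R := Algebra.subset_adjoin (Set.mem_insert _ _)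

theorem iota_mem_R (f : M) : iota f ∈ R := by
  have hle : eisensteinSubalgebra ≤ R.comap iota := by
    refine Algebra.adjoin_le ?_
    rintro _ (rfl | rfl)
    · exact Algebra.subset_adjoin (Or.inr (Or.inl (iota_of 4 ModularForm.E₄)))
    · exact Algebra.subset_adjoin (Or.inr (Or.inr (iota_of 6 ModularForm.E₆)))
  exact hle (eisensteinSubalgebra_eq_top ▸ trivial)

theorem orderLT_le_R (n : ℕ) : orderLT iota delta n ≤ Subalgebra.toSubmodule R :=
  orderLT_le_iff.mpr fun i _ f => R.mul_mem (iota_mem_R f) (R.pow_mem delta_mem_R i)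

theorem exists_mem_orderLT_of_mem_R {a : EndH} (ha : a ∈ R) :
    ∃ n, a ∈ orderLT iota delta n := by
  refine exists_mem_orderLT_of_mem_adjoin delta_mul_iota (Algebra.adjoin_mono ?_ ha)
  rintro _ (rfl | rfl | rfl)
  · exact Set.mem_insert _ _
  · exact Or.inr ⟨_, iota_of 4 ModularForm.E₄⟩
  · exact Or.inr ⟨_, iota_of 6 ModularForm.E₆⟩

end OperatorAlgebra

section Independence

/-- The function `z ↦ z - z₀` on the upper half plane. Applying `δ` lowers its order of vanishing at
`z₀` by exactly one, which separates the powers of `δ`. -/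
def subConst (z₀ : ℍ) : Hol :=
  ⟨fun z => (z : ℂ) - z₀, UpperHalfPlane.mdifferentiable_coe.sub mdifferentiable_const⟩

/-- Evaluation at a point of the upper half plane. -/
def evalAt (z₀ : ℍ) : Hol →ₐ[ℂ] ℂ := (Pi.evalAlgHom ℂ (fun _ : ℍ => ℂ) z₀).comp Hol.val

theorem evalAt_subConst (z₀ : ℍ) : evalAt z₀ (subConst z₀) = 0 := sub_self _

theorem serre_zero_subConst (z₀ : ℍ) :
    serre 0 (subConst z₀) = algebraMap ℂ Hol (2 * Real.pi * Complex.I)⁻¹ := by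
  refine Subtype.ext (funext fun z => ?_)
  have hloc : (subConst z₀).1 ∘ ofComplex =ᶠ[nhds (z : ℂ)] fun w => w - z₀ := by
    filter_upwards [isOpen_upperHalfPlaneSet.mem_nhds z.im_pos] with w hw
    exact congrArg (· - (z₀ : ℂ)) (congrArg UpperHalfPlane.coe (ofComplex_apply_of_im_pos hw))
  have hderiv : deriv ((subConst z₀).1 ∘ ofComplex) z = 1 := by
    rw [hloc.deriv_eq, deriv_sub_const, deriv_id'']
  calc Derivative.serreDerivative ((0 : ℝ) : ℂ) (subConst z₀).1 z
      = (2 * Real.pi * Complex.I)⁻¹ := by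
        rw [Derivative.serreDerivative_apply, Derivative.normalizedDerivOfComplex, hderiv]
        simp
    _ = _ := rfl

theorem serre_zero_pow (f : Hol) (s : ℕ) :
    serre 0 (f ^ (s + 1)) = ((s : ℂ) + 1) • (f ^ s * serre 0 f) := by
  have hleibniz (f g : Hol) : serre 0 (f * g) = f • serre 0 g + g • serre 0 f := by
    have h := serre_mul 0 0 f g
    rw [add_zero] at h
    rw [h, add_comm, smul_eq_mul, smul_eq_mul, mul_comm g]
  have h := (Derivation.mk' (serre 0) hleibniz).leibniz_pow f (s + 1)
  rw [Nat.add_sub_cancel, smul_eq_mul, ← Nat.cast_smul_eq_nsmul ℂ, Nat.cast_succ] at h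
  exact h

theorem exists_serre_subConst_pow_mul (z₀ : ℍ) (n : ℝ) (s : ℕ) {h : Hol} (hh : evalAt z₀ h ≠ 0) :
    ∃ h' : Hol, serre n (subConst z₀ ^ (s + 1) * h) = subConst z₀ ^ s * h' ∧
      evalAt z₀ h' ≠ 0 := by
  refine ⟨(((s : ℂ) + 1) * (2 * Real.pi * Complex.I)⁻¹) • h + subConst z₀ * serre n h, ?_, ?_⟩
  · have hmul := serre_mul 0 n (subConst z₀ ^ (s + 1)) h
    rw [zero_add] at hmul
    rw [hmul, serre_zero_pow, serre_zero_subConst, Algebra.smul_def, Algebra.smul_def, map_mul]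
    ring
  · rw [map_add, map_mul, evalAt_subConst, zero_mul, add_zero, map_smul, smul_eq_mul]
    exact mul_ne_zero (mul_ne_zero (Nat.cast_add_one_ne_zero s)
      (inv_ne_zero Complex.two_pi_I_ne_zero)) hh

theorem exists_delta_pow_single_subConst_pow (z₀ : ℍ) (n : ℝ) {N l : ℕ} (hl : l ≤ N) :
    ∃ h : Hol, (delta ^ l) (Finsupp.single n (subConst z₀ ^ N)) =
      Finsupp.single (n + 2 * l) (subConst z₀ ^ (N - l) * h) ∧ evalAt z₀ h ≠ 0 := by
  induction l with
  | zero => exact ⟨1, by simp, by simp⟩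
  | succ l ih =>
    obtain ⟨h, hl', hh⟩ := ih (by omega)
    obtain ⟨h', hserre, hh'⟩ :=
      exists_serre_subConst_pow_mul z₀ (n + 2 * l) (N - (l + 1)) hh
    refine ⟨h', ?_, hh'⟩
    rw [pow_succ', Module.End.mul_apply, hl', delta, shift_single,
      show N - l = N - (l + 1) + 1 by omega, hserre]
    congr 1
    push_cast
    ring

theorem exists_iota_mul_delta_pow_single_apply (z₀ : ℍ) (f : M) (n : ℝ) {N l : ℕ} (hl : l ≤ N)
    (k : ℤ) : ∃ h : Hol, evalAt z₀ h ≠ 0 ∧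
      (iota f * delta ^ l) (Finsupp.single n (subConst z₀ ^ N)) (n + k) =
        toHol (k - 2 * l) (f (k - 2 * l)) * (subConst z₀ ^ (N - l) * h) := by
  obtain ⟨h, hl', hh⟩ := exists_delta_pow_single_subConst_pow z₀ n hl
  refine ⟨h, hh, ?_⟩
  rw [Module.End.mul_apply, hl', ← iota_single_apply]
  congr 1
  push_cast
  ring

theorem evalAt_apply_single_eq_zero (z₀ : ℍ) {N : ℕ} {a : EndH} (ha : a ∈ orderLT iota delta N)
    (n : ℝ) (k : ℤ) : evalAt z₀ (a (Finsupp.single n (subConst z₀ ^ N)) (n + k)) = 0 := by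
  have hle : orderLT iota delta N ≤ LinearMap.ker ((evalAt z₀).toLinearMap ∘ₗ
      Finsupp.lapply (n + k) ∘ₗ LinearMap.applyₗ (Finsupp.single n (subConst z₀ ^ N))) := by
    refine orderLT_le_iff.mpr fun l hl f => ?_
    obtain ⟨h, -, hval⟩ := exists_iota_mul_delta_pow_single_apply z₀ f n hl.le k
    change evalAt z₀ ((iota f * delta ^ l) (Finsupp.single n (subConst z₀ ^ N)) (n + k)) = 0
    rw [hval, map_mul, map_mul, map_pow, evalAt_subConst, zero_pow (Nat.sub_pos_of_lt hl).ne',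
      zero_mul, mul_zero]
  exact hle ha

theorem eq_zero_of_iota_mul_delta_pow_mem_orderLT (n : ℕ) (f : M)
    (hf : iota f * delta ^ n ∈ orderLT iota delta n) : f = 0 := by
  refine DFinsupp.ext fun k => DFunLike.ext _ _ fun z₀ => ?_
  obtain ⟨h, hh, hval⟩ :=
    exists_iota_mul_delta_pow_single_apply z₀ f 0 (le_refl n) (k + 2 * n)
  have hzero := evalAt_apply_single_eq_zero z₀ hf 0 (k + 2 * n)
  rw [hval, add_sub_cancel_right, Nat.sub_self, pow_zero, one_mul, map_mul] at hzero
  exact (mul_eq_zero.mp hzero).resolve_right hh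

end Independence

section Order

theorem ofCoeffs_eq_eval₂ (P : Polynomial M) : ofCoeffs P = P.eval₂ (iota : M →+* EndH) delta :=
  Polynomial.eval₂_eq_sum.symm

theorem ofCoeffs_injective : Function.Injective ofCoeffs := by
  simpa only [← ofCoeffs_eq_eval₂] using
    eval₂_injective_of_forall_mem_orderLT eq_zero_of_iota_mul_delta_pow_mem_orderLT

theorem coeffs_ofCoeffs (P : Polynomial M) : coeffs (ofCoeffs P) = P := by
  have h : ∃ Q, ofCoeffs Q = ofCoeffs P := ⟨P, rfl⟩
  rw [coeffs, dif_pos h]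
  exact ofCoeffs_injective h.choose_spec

theorem mem_orderLT_iff_ofCoeffs {n : ℕ} {a : EndH} :
    a ∈ orderLT iota delta n ↔ ∃ P : Polynomial M, P.degree < n ∧ ofCoeffs P = a := by
  simp only [mem_orderLT_iff, ofCoeffs_eq_eval₂]

theorem ofCoeffs_coeffs {a : EndH} (ha : a ∈ R) : ofCoeffs (coeffs a) = a := by
  obtain ⟨n, hn⟩ := exists_mem_orderLT_of_mem_R ha
  obtain ⟨P, -, rfl⟩ := mem_orderLT_iff_ofCoeffs.mp hn
  rw [coeffs_ofCoeffs]

theorem mem_orderLT_iff_ord_lt {n : ℕ} {a : EndH} (ha : a ∈ R) :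
    a ∈ orderLT iota delta n ↔ ord a < n := by
  refine mem_orderLT_iff_ofCoeffs.trans ⟨?_, fun h => ⟨coeffs a, h, ofCoeffs_coeffs ha⟩⟩
  rintro ⟨P, hP, rfl⟩
  rwa [ord, coeffs_ofCoeffs]

theorem ord_eq_of_mem_of_notMem {n : ℕ} {a : EndH} (hmem : a ∈ orderLT iota delta (n + 1))
    (hnot : a ∉ orderLT iota delta n) : ord a = n := by
  have ha := orderLT_le_R _ hmem
  rw [mem_orderLT_iff_ord_lt ha] at hmem hnot
  exact le_antisymm (Order.le_of_lt_succ hmem) (not_lt.mp hnot)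

theorem hasSymbol_top {n : ℕ} {a : EndH} (ha : a ∈ R) (h : ord a = n) :
    HasSymbol iota delta n (top a) a := by
  have hcoeffs : coeffs a ≠ 0 := Polynomial.degree_ne_bot.mp (h.trans_ne (WithBot.natCast_ne_bot n))
  have hsplit := congrArg (Polynomial.eval₂ (iota : M →+* EndH) delta)
    (coeffs a).eraseLead_add_monomial_natDegree_leadingCoeff
  rw [Polynomial.eval₂_add, Polynomial.eval₂_monomial, ← ofCoeffs_eq_eval₂, ← ofCoeffs_eq_eval₂,
    ofCoeffs_coeffs ha, Polynomial.natDegree_eq_of_degree_eq_some h] at hsplit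
  exact mem_orderLT_iff_ofCoeffs.mpr ⟨_, (Polynomial.degree_eraseLead_lt hcoeffs).trans_eq h,
    eq_sub_of_add_eq hsplit⟩

theorem top_ne_zero {n : ℕ} {a : EndH} (h : ord a = n) : top a ≠ 0 :=
  Polynomial.leadingCoeff_ne_zero.mpr
    (Polynomial.degree_ne_bot.mp (h.trans_ne (WithBot.natCast_ne_bot n)))

theorem iota_mul_notMem_orderLT {n : ℕ} {f : M} (hf : f ≠ 0) {a : EndH} (ha : a ∈ R)
    (h : ord a = n) : iota f * a ∉ orderLT iota delta n := by
  have hsymbol := (hasSymbol_iota f).mul delta_mul_iota (hasSymbol_top ha h)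
  rw [zero_add] at hsymbol
  exact hsymbol.notMem_orderLT eq_zero_of_iota_mul_delta_pow_mem_orderLT
    (mul_ne_zero hf (top_ne_zero h))

theorem mul_iota_notMem_orderLT {n : ℕ} {f : M} (hf : f ≠ 0) {a : EndH} (ha : a ∈ R)
    (h : ord a = n) : a * iota f ∉ orderLT iota delta n := by
  have hsymbol := (hasSymbol_top ha h).mul delta_mul_iota (hasSymbol_iota f)
  exact hsymbol.notMem_orderLT eq_zero_of_iota_mul_delta_pow_mem_orderLT
    (mul_ne_zero (top_ne_zero h) hf)

theorem ord_eq_of_mul_add_notMem_left {j r : ℕ} {b c c' : EndH}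
    (hb : b ∈ orderLT iota delta (j + 1)) (hc : c ∈ orderLT iota delta (r + 1))
    (hc' : c' ∈ orderLT iota delta j) (h : c * b + c' ∉ orderLT iota delta (j + r)) :
    ord c = r :=
  ord_eq_of_mem_of_notMem hc (notMem_orderLT_of_mul_add_notMem_left delta_mul_iota hb hc' h)

theorem ord_eq_of_mul_add_notMem_right {j r : ℕ} {b c c' : EndH}
    (hb : b ∈ orderLT iota delta (j + 1)) (hc : c ∈ orderLT iota delta (r + 1))
    (hc' : c' ∈ orderLT iota delta j) (h : b * c + c' ∉ orderLT iota delta (j + r)) :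
    ord c = r :=
  ord_eq_of_mem_of_notMem hc (notMem_orderLT_of_mul_add_notMem_right delta_mul_iota hb hc' h)

theorem exists_eq_mul_add_of_mem_leftDivisible {j r : ℕ} {b x : EndH}
    (hb : b ∈ orderLT iota delta (j + 1)) (hx : x ∉ orderLT iota delta (j + r))
    (h : x ∈ leftDivisible iota delta j (r + 1) b) :
    ∃ c ∈ R, ∃ c' ∈ R, ord c = r ∧ ord c' < j ∧ x = c * b + c' := by
  obtain ⟨c, hc, c', hc', rfl⟩ := mem_leftDivisible_iff.mp h
  have hc'R := orderLT_le_R _ hc'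
  exact ⟨c, orderLT_le_R _ hc, c', hc'R, ord_eq_of_mul_add_notMem_left hb hc hc' hx,
    (mem_orderLT_iff_ord_lt hc'R).mp hc', rfl⟩

theorem exists_eq_mul_add_of_mem_rightDivisible {j r : ℕ} {b x : EndH}
    (hb : b ∈ orderLT iota delta (j + 1)) (hx : x ∉ orderLT iota delta (j + r))
    (h : x ∈ rightDivisible iota delta j (r + 1) b) :
    ∃ c ∈ R, ∃ c' ∈ R, ord c = r ∧ ord c' < j ∧ x = b * c + c' := by
  obtain ⟨c, hc, c', hc', rfl⟩ := mem_rightDivisible_iff.mp h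
  have hc'R := orderLT_le_R _ hc'
  exact ⟨c, orderLT_le_R _ hc, c', hc'R, ord_eq_of_mul_add_notMem_right hb hc hc' hx,
    (mem_orderLT_iff_ord_lt hc'R).mp hc', rfl⟩

end Order

section Weight

/-- The weight `w` part of an endomorphism of `H`. -/
def weightPart (w : ℝ) : EndH →ₗ[ℂ] EndH where
  toFun φ := shift w fun n => Finsupp.lapply (n + w) ∘ₗ φ ∘ₗ Finsupp.lsingle n
  map_add' φ ψ := Finsupp.lhom_ext fun n f => by
    rw [LinearMap.add_apply]
    simp [shift_single]
  map_smul' c φ := Finsupp.lhom_ext fun n f => by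
    rw [LinearMap.smul_apply]
    simp [shift_single]

theorem weightPart_single (w : ℝ) (φ : EndH) (n : ℝ) (f : Hol) :
    weightPart w φ (Finsupp.single n f) =
      Finsupp.single (n + w) (φ (Finsupp.single n f) (n + w)) :=
  shift_single _ _ _ _

theorem weightPart_mem_endWeight (w : ℝ) (φ : EndH) : weightPart w φ ∈ endWeight w :=
  fun n f => ⟨_, weightPart_single w φ n f⟩

theorem weightPart_eq_self {w : ℝ} {φ : EndH} (h : φ ∈ endWeight w) : weightPart w φ = φ :=
  Finsupp.lhom_ext fun n f => by
    obtain ⟨g, hg⟩ := h n f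
    rw [weightPart_single, hg, Finsupp.single_eq_same]

theorem weightPart_mul {v m w : ℝ} (h : v + m = w) (φ : EndH) {ψ : EndH} (hψ : ψ ∈ endWeight m) :
    weightPart w (φ * ψ) = weightPart v φ * ψ :=
  Finsupp.lhom_ext fun n f => by
    obtain ⟨g, hg⟩ := hψ n f
    rw [weightPart_single, Module.End.mul_apply, Module.End.mul_apply, hg, weightPart_single,
      show n + m + v = n + w by rw [← h]; ring]

theorem apply_add_of_mem_endWeight {m : ℝ} {ψ : EndH} (hψ : ψ ∈ endWeight m) (x : H) (n : ℝ) :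
    ψ x (n + m) = ψ (Finsupp.single n (x n)) (n + m) := by
  induction x using Finsupp.induction_linear with
  | zero => simp
  | add x y hx hy => simp [hx, hy]
  | single s f =>
    rcases eq_or_ne s n with rfl | hsn
    · rw [Finsupp.single_eq_same]
    · obtain ⟨g, hg⟩ := hψ s f
      rw [hg, Finsupp.single_eq_of_ne hsn.symm, Finsupp.single_zero, map_zero,
        Finsupp.single_eq_of_ne (by simpa using hsn.symm), Finsupp.coe_zero, Pi.zero_apply]

theorem mul_weightPart {v m w : ℝ} (h : m + v = w) {ψ : EndH} (hψ : ψ ∈ endWeight m) (φ : EndH) :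
    weightPart w (ψ * φ) = ψ * weightPart v φ := by
  refine Finsupp.lhom_ext fun n f => ?_
  obtain ⟨g, hg⟩ := hψ (n + v) (φ (Finsupp.single n f) (n + v))
  rw [weightPart_single, Module.End.mul_apply, Module.End.mul_apply, weightPart_single,
    show n + w = n + v + m by rw [← h]; ring, apply_add_of_mem_endWeight hψ, hg,
    Finsupp.single_eq_same]

theorem mul_mem_endWeight {v m : ℝ} {φ ψ : EndH} (hφ : φ ∈ endWeight v) (hψ : ψ ∈ endWeight m) :
    φ * ψ ∈ endWeight (v + m) := by
  have hmem := weightPart_mem_endWeight (v + m) (φ * ψ)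
  rwa [weightPart_mul rfl φ hψ, weightPart_eq_self hφ] at hmem

theorem pow_mem_endWeight {w : ℝ} {φ : EndH} (h : φ ∈ endWeight w) (k : ℕ) :
    φ ^ k ∈ endWeight (k * w) := by
  induction k with
  | zero => exact fun n f => ⟨f, by simp⟩
  | succ k ih =>
    rw [pow_succ, Nat.cast_succ, add_one_mul]
    exact mul_mem_endWeight ih h

theorem delta_mem_endWeight : delta ∈ endWeight 2 := fun _ _ => ⟨_, shift_single _ _ _ _⟩

theorem mulForm_mem_endWeight (k : ℤ) (F : ModularForm 𝒮ℒ k) : mulForm k F ∈ endWeight k :=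
  fun _ _ => ⟨_, mulForm_single _ _ _ _⟩

theorem iota_mem_endWeight {k : ℤ} {f : M} (h : f ∈ MWeight k) : iota f ∈ endWeight k := by
  obtain ⟨F, rfl⟩ := h
  rw [iota_lof]
  exact mulForm_mem_endWeight k F

theorem iota_pow_mul_mem_endWeight {b' d : M} {k l : ℤ} (hb' : b' ∈ MWeight (k - l))
    (hd : d ∈ MWeight l) (r : ℕ) :
    iota ((b' * d) ^ r * b') ∈ endWeight ((k * (r + 1) - l : ℤ) : ℝ) := by
  have hmem := mul_mem_endWeight
    (pow_mem_endWeight (mul_mem_endWeight (iota_mem_endWeight hb') (iota_mem_endWeight hd)) r)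
    (iota_mem_endWeight hb')
  rw [← map_mul, ← map_pow, ← map_mul] at hmem
  convert hmem using 2
  push_cast
  ring

theorem weightPart_mulForm_of_ne {k : ℤ} {w : ℝ} (h : (k : ℝ) ≠ w) (F : ModularForm 𝒮ℒ k) :
    weightPart w (mulForm k F) = 0 :=
  Finsupp.lhom_ext fun n f => by
    rw [weightPart_single, mulForm_single, Finsupp.single_eq_of_ne (by simpa using h.symm),
      Finsupp.single_zero, LinearMap.zero_apply]

theorem exists_weightPart_iota (w : ℝ) (f : M) : ∃ g, weightPart w (iota f) = iota g := by
  induction f using DirectSum.induction_on with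
  | zero => exact ⟨0, by simp⟩
  | add x y hx hy =>
    obtain ⟨g, hg⟩ := hx
    obtain ⟨h, hh⟩ := hy
    exact ⟨g + h, by rw [map_add, map_add, hg, hh, map_add]⟩
  | of k F =>
    rcases eq_or_ne (k : ℝ) w with rfl | h
    · exact ⟨DirectSum.of (ModularForm 𝒮ℒ) k F, by
        rw [iota_of, weightPart_eq_self (mulForm_mem_endWeight k F)]⟩
    · exact ⟨0, by rw [iota_of, weightPart_mulForm_of_ne h, map_zero]⟩

theorem weightPart_mem_orderLT (w : ℝ) {n : ℕ} {a : EndH} (ha : a ∈ orderLT iota delta n) :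
    weightPart w a ∈ orderLT iota delta n := by
  have hle : orderLT iota delta n ≤ (orderLT iota delta n).comap (weightPart w) := by
    refine orderLT_le_iff.mpr fun i hi f => ?_
    obtain ⟨g, hg⟩ := exists_weightPart_iota (w - i * 2) f
    rw [Submodule.mem_comap,
      weightPart_mul (sub_add_cancel w _) _ (pow_mem_endWeight delta_mem_endWeight i), hg]
    exact iota_mul_pow_mem_orderLT hi g
  exact hle ha

theorem weightPart_mem_RWeight (w : ℤ) {n : ℕ} {a : EndH} (ha : a ∈ orderLT iota delta n) :
    weightPart w a ∈ RWeight w :=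
  ⟨orderLT_le_R n (weightPart_mem_orderLT w ha), weightPart_mem_endWeight w a⟩

variable {j r : ℕ} {b x : EndH} {m p q : ℤ}

theorem exists_mem_RWeight_eq_mul_add_of_mem_leftDivisible (hpq : p + m = q)
    (hbm : b ∈ endWeight m) (hxq : x ∈ endWeight q) (hb : b ∈ orderLT iota delta (j + 1))
    (hx : x ∉ orderLT iota delta (j + r)) (h : x ∈ leftDivisible iota delta j (r + 1) b) :
    ∃ c ∈ RWeight p, ∃ c' ∈ RWeight q, ord c = r ∧ ord c' < j ∧ x = c * b + c' := by
  obtain ⟨c, hc, c', hc', hxc⟩ := mem_leftDivisible_iff.mp h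
  have hparts : x = weightPart p c * b + weightPart q c' := by
    rw [← weightPart_mul (w := q) (by exact_mod_cast hpq) c hbm, ← map_add, ← hxc,
      weightPart_eq_self hxq]
  have hrem := weightPart_mem_orderLT q hc'
  exact ⟨_, weightPart_mem_RWeight p hc, _, weightPart_mem_RWeight q hc',
    ord_eq_of_mul_add_notMem_left hb (weightPart_mem_orderLT p hc) hrem (hparts ▸ hx),
    (mem_orderLT_iff_ord_lt (orderLT_le_R j hrem)).mp hrem, hparts⟩

theorem exists_mem_RWeight_eq_mul_add_of_mem_rightDivisible (hpq : p + m = q)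
    (hbm : b ∈ endWeight m) (hxq : x ∈ endWeight q) (hb : b ∈ orderLT iota delta (j + 1))
    (hx : x ∉ orderLT iota delta (j + r)) (h : x ∈ rightDivisible iota delta j (r + 1) b) :
    ∃ c ∈ RWeight p, ∃ c' ∈ RWeight q, ord c = r ∧ ord c' < j ∧ x = b * c + c' := by
  obtain ⟨c, hc, c', hc', hxc⟩ := mem_rightDivisible_iff.mp h
  have hparts : x = b * weightPart p c + weightPart q c' := by
    rw [← mul_weightPart (w := q) (by exact_mod_cast (add_comm m p).trans hpq) hbm c, ← map_add,
      ← hxc, weightPart_eq_self hxq]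
  have hrem := weightPart_mem_orderLT q hc'
  exact ⟨_, weightPart_mem_RWeight p hc, _, weightPart_mem_RWeight q hc',
    ord_eq_of_mul_add_notMem_right hb (weightPart_mem_orderLT p hc) hrem (hparts ▸ hx),
    (mem_orderLT_iff_ord_lt (orderLT_le_R j hrem)).mp hrem, hparts⟩

end Weight

end MLDO

end

open MLDO in
theorem mainTheorem5_general {i j : ℕ} (hij : j ≤ i) {a b : EndH} {d a' b' : M}
    (ha : a ∈ R) (hai : ord a = i) (hb : b ∈ R) (hbj : ord b = j)
    (hta : top a = a' * d) (htb : top b = b' * d) :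
    ((∃ c ∈ R, ∃ c' ∈ R, ord c = (i - j : ℕ) ∧ ord c' < j ∧
        iota (top b ^ (i - j) * b') * a = c * b + c') ∧
      (∃ c ∈ R, ∃ c' ∈ R, ord c = (i - j : ℕ) ∧ ord c' < j ∧
        a * iota (top b ^ (i - j) * b') = b * c + c') ∧
      (∃ c ∈ R, ∃ c' ∈ R, ord c = (i - j : ℕ) ∧ ord c' < j ∧
        a * iota (top b ^ (i - j) * b') = c * b + c')) ∧
    ∀ m n l p q : ℤ, p = (m - 2 * j) * (i - j + 1) - l - m + n →
      q = (m - 2 * j) * (i - j + 1) - l + n →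
      a ∈ endWeight n → b ∈ endWeight m →
      d ∈ MWeight l → b' ∈ MWeight (m - 2 * j - l) →
      (∃ c ∈ RWeight p, ∃ c' ∈ RWeight q,
        ord c = (i - j : ℕ) ∧ ord c' < j ∧
        iota (top b ^ (i - j) * b') * a = c * b + c') ∧
      (∃ c ∈ RWeight p, ∃ c' ∈ RWeight q,
        ord c = (i - j : ℕ) ∧ ord c' < j ∧
        a * iota (top b ^ (i - j) * b') = b * c + c') ∧
      (∃ c ∈ RWeight p, ∃ c' ∈ RWeight q,
        ord c = (i - j : ℕ) ∧ ord c' < j ∧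
        a * iota (top b ^ (i - j) * b') = c * b + c') := by
  obtain ⟨r, rfl⟩ := Nat.exists_eq_add_of_le hij
  rw [Nat.add_sub_cancel_left]
  have hsa := hasSymbol_top ha hai
  have hsb := hasSymbol_top hb hbj
  have hf : top b ^ r * b' ≠ 0 := mul_ne_zero (pow_ne_zero r (top_ne_zero hbj))
    (left_ne_zero_of_mul (htb ▸ top_ne_zero hbj))
  have hab : b' * top a = a' * top b := by rw [hta, htb, mul_left_comm]
  have hxl := iota_mul_notMem_orderLT hf ha hai
  have hxr := mul_iota_notMem_orderLT hf ha hai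
  have hll := iota_pow_mul_mul_mem_leftDivisible delta_mul_iota hsa hsb hab
  have hrr := mul_iota_pow_mul_mem_rightDivisible delta_mul_iota hsa hsb hab
  have hrl := mul_iota_pow_mul_mem_leftDivisible delta_mul_iota hsa hsb hab ⟨d, htb⟩
  have hbo := hsb.mem_orderLT
  refine ⟨⟨exists_eq_mul_add_of_mem_leftDivisible hbo hxl hll,
    exists_eq_mul_add_of_mem_rightDivisible hbo hxr hrr,
    exists_eq_mul_add_of_mem_leftDivisible hbo hxr hrl⟩,
    fun m n l p q hp hq han hbm hd hb' => ?_⟩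
  have hpq : p + m = q := by rw [hp, hq]; ring
  have hq' : (((m - 2 * j) * (r + 1) - l : ℤ) : ℝ) + n = q := by rw [hq]; push_cast; ring
  have hw := htb ▸ iota_pow_mul_mem_endWeight hb' hd r
  have hwl := hq' ▸ mul_mem_endWeight hw han
  have hwr := (add_comm _ _).trans hq' ▸ mul_mem_endWeight han hw
  exact ⟨exists_mem_RWeight_eq_mul_add_of_mem_leftDivisible hpq hbm hwl hbo hxl hll,
    exists_mem_RWeight_eq_mul_add_of_mem_rightDivisible hpq hbm hwr hbo hxr hrr,
    exists_mem_RWeight_eq_mul_add_of_mem_leftDivisible hpq hbm hwr hbo hxr hrl⟩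

theorem mainTheorem5 :
    -- inhomogeneous version
    (∀ (i j : ℕ) (_ : j ≤ i) (a b : MLDO.EndH) (d a' b' : MLDO.M),
      a ∈ MLDO.R → MLDO.ord a = (i : WithBot ℕ) →
      b ∈ MLDO.R → MLDO.ord b = (j : WithBot ℕ) →
      MLDO.top a = a' * d → MLDO.top b = b' * d →
      (∃ c ∈ MLDO.R, ∃ c' ∈ MLDO.R,
        MLDO.ord c = ((i - j : ℕ) : WithBot ℕ) ∧ MLDO.ord c' < (j : WithBot ℕ) ∧
        MLDO.iota (MLDO.top b ^ (i - j) * b') * a = c * b + c') ∧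
      (∃ c ∈ MLDO.R, ∃ c' ∈ MLDO.R,
        MLDO.ord c = ((i - j : ℕ) : WithBot ℕ) ∧ MLDO.ord c' < (j : WithBot ℕ) ∧
        a * MLDO.iota (MLDO.top b ^ (i - j) * b') = b * c + c')) ∧
    -- homogeneous version
    (∀ (i j : ℕ) (_ : j ≤ i) (m n l p q : ℤ) (_ : 0 ≤ m) (_ : 0 ≤ n)
      (_ : p = (m - 2 * j) * (i - j + 1) - l - m + n)
      (_ : q = (m - 2 * j) * (i - j + 1) - l + n)
      (a b : MLDO.EndH) (d a' b' : MLDO.M),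
      a ∈ MLDO.RWeight n → MLDO.ord a = (i : WithBot ℕ) →
      b ∈ MLDO.RWeight m → MLDO.ord b = (j : WithBot ℕ) →
      d ∈ MLDO.MWeight l → a' ∈ MLDO.MWeight (n - 2 * i - l) →
      b' ∈ MLDO.MWeight (m - 2 * j - l) →
      MLDO.top a = a' * d → MLDO.top b = b' * d →
      (∃ c ∈ MLDO.RWeight p, ∃ c' ∈ MLDO.RWeight q,
        MLDO.ord c = ((i - j : ℕ) : WithBot ℕ) ∧ MLDO.ord c' < (j : WithBot ℕ) ∧
        MLDO.iota (MLDO.top b ^ (i - j) * b') * a = c * b + c') ∧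
      (∃ c ∈ MLDO.RWeight p, ∃ c' ∈ MLDO.RWeight q,
        MLDO.ord c = ((i - j : ℕ) : WithBot ℕ) ∧ MLDO.ord c' < (j : WithBot ℕ) ∧
        a * MLDO.iota (MLDO.top b ^ (i - j) * b') = b * c + c') ∧
      (∃ c ∈ MLDO.RWeight p, ∃ c' ∈ MLDO.RWeight q,
        MLDO.ord c = ((i - j : ℕ) : WithBot ℕ) ∧ MLDO.ord c' < (j : WithBot ℕ) ∧
        a * MLDO.iota (MLDO.top b ^ (i - j) * b') = c * b + c')) := by
  exact ⟨fun _ _ hij _ _ _ _ _ ha hai hb hbj hta htb =>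
      ⟨(mainTheorem5_general hij ha hai hb hbj hta htb).1.1,
        (mainTheorem5_general hij ha hai hb hbj hta htb).1.2.1⟩,
    fun _ _ hij m n l p q _ _ hp hq _ _ _ _ _ ha hai hb hbj hd _ hb' hta htb =>
      (mainTheorem5_general hij ha.1 hai hb.1 hbj hta htb).2 m n l p q hp hq ha.2 hb.2 hd hb'⟩
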